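/- Let $G$ be a graph and $A,B\subseteq V(G)$ disjoint, and write $d_G(X,Y)=e_G(X,Y)/(|X||Y|)$ for non-empty $X\subseteq A$, $Y\subseteq B$. The pair $(A,B)$ is $(\varepsilon,d)$-regular in $G$ if $d_G(A,B)=d$ and $|d_G(A,B)-d_G(X,Y)|<\varepsilon$ for all $X\subseteq A$, $Y\subseteq B$ with $|X|\ge\varepsilon|A|$ and $|Y|\ge\varepsilon|B|$. A tripartite graph $\Gamma$ with parts $V^1,V^2,V^3$ is $(\varepsilon,d)$-regular if each pair $(V^i,V^j)$, $i\ne j$, is $(\varepsilon,d)$-regular in $\Gamma$. For $p\in[0,1]$ let $\Gamma_p$ be the random subgraph of $\Gamma$ on the same vertex set in which each edge of $\Gamma$ is kept independently with probability $p$. Let $D_t$ be the graph on $\{1,\dots,t\}\times\{1,2,3\}$ with edges $\{(s,i),(s,j)\}$ for $1\le s\le t$, $i\ne j$ (that is, $t$ labelled vertex-disjoint triangles). For a graph $G$ on $V^1\cup V^2\cup V^3$ let $\Psi^t(G)$ be the set of embeddings (injective graph homomorphisms) of $D_t$ into $G$ that map $\{1,\dots,t\}\times\{i\}$ into $V^i$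 for $i=1,2,3$. Finally let $n!_t=n(n-1)\cdots(n-t+1)$, with $n!_0=1$. **Proposition.** For all $0<\eta,d\le 1$ there exist $\varepsilon>0$ and $C>0$ such that for every $\delta>0$ the following holds for all sufficiently large $n\in\mathbb N$ (depending only on $\eta,d,\varepsilon,C,\delta$), all $p\in[0,1]$ with $p\ge C(\log n)^{1/3}n^{-2/3}$, and every $(\varepsilon,d)$-regular tripartite graph $\Gamma$ with parts $V^1,V^2,V^3$ of size $n$. With probability at least $1-\delta$, simultaneously for all integers $t\ge 0$ with $t\le(1-\eta)n$, $$|\Psi^t(\Gamma_p)|\ \ge\ (1-\eta)^t\,(pd)^{3t}\,(n!_t)^3 .$$ -/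

import Mathlib

open MeasureTheory ProbabilityTheory Filter

namespace TriangleFactor

/-- `G` is a tripartite graph with parts `P 0`, `P 1`, `P 2`: the three parts are pairwise
disjoint, they cover the vertex set, and no edge lies inside a part. -/
structure IsTripartite {V : Type*} (G : SimpleGraph V) (P : Fin 3 → Finset V) : Prop where
  disjoint : ∀ i j, i ≠ j → Disjoint (P i) (P j)
  cover : ∀ v, ∃ i, v ∈ P i
  not_adj : ∀ i, ∀ v ∈ P i, ∀ w ∈ P i, ¬ G.Adj v w

open Classical in
/-- The pair `(A, B)` is `(ε, d)`-regular in `G`: it is `ε`-regular (which is Mathlib's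
`SimpleGraph.IsUniform`) and its density is exactly `d`. -/
def IsRegularPair {V : Type*} (G : SimpleGraph V) (ε d : ℝ) (A B : Finset V) : Prop :=
  G.IsUniform ε A B ∧ (G.edgeDensity A B : ℝ) = d

/-- `G` is an `(ε, d)`-regular tripartite graph with parts `P 0`, `P 1`, `P 2`. -/
def IsRegularTripartite {V : Type*} (G : SimpleGraph V) (P : Fin 3 → Finset V) (ε d : ℝ) : Prop :=
  IsTripartite G P ∧ ∀ i j, i ≠ j → IsRegularPair G ε d (P i) (P j)

/-- The law of the random subgraph `Γ_p` (on the same vertex set), in which every edge of `Γ` is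
present independently with probability `p`. -/
noncomputable def sparsification {V : Type*} (Γ : SimpleGraph V) (p : unitInterval) :
    Measure (SimpleGraph V) :=
  (setBernoulli Γ.edgeSet p).map SimpleGraph.fromEdgeSet

/-- The graph `D_t` on `[t] × [3]`, consisting of `t` labelled vertex-disjoint triangles. -/
def disjointTriangles (t : ℕ) : SimpleGraph (Fin t × Fin 3) where
  Adj x y := x.1 = y.1 ∧ x.2 ≠ y.2
  symm := ⟨fun _ _ h => ⟨h.1.symm, h.2.symm⟩⟩
  loopless := ⟨fun _ h => h.2 rfl⟩

/-- The set `Ψ^t(G)` of labelled embeddings (injective homomorphisms) of `D_t` into `G` that map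
`[t] × {i}` into the part `P i`, for each `i`. -/
def triangleEmbeddings {V : Type*} (P : Fin 3 → Finset V) (t : ℕ) (G : SimpleGraph V) :
    Set (SimpleGraph.Copy (disjointTriangles t) G) :=
  {ψ | ∀ s i, ψ (s, i) ∈ P i}

end TriangleFactor

/-!
The triangles of `Γ_p` are counted greedily. If every triple of sets `X ⊆ P 0`, `Y ⊆ P 1`,
`Z ⊆ P 2` of common size `m ≥ η n` spans at least `(1 - η) (p d)³ m³` triangles of `Γ_p`, then any
`t < (1 - η) n` disjoint triangles leave `n - t ≥ η n` free vertices in each part, hence can be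
extended in at least `(1 - η) (p d)³ (n - t)³` ways, and the product of these numbers is the claimed
bound (`le_ncard_triangleEmbeddings`). This event does not depend on `t`, so all `t` are treated
simultaneously.

It remains to bound the probability that some triple `(X, Y, Z)` spans too few triangles. In `Γ`
itself it spans at least `(1 - η / 2) d³ m³` of them by the triangle counting lemma
(`le_card_crossTriangles`). Janson's inequality (`janson`, `crossTriangles_lower_tail`) bounds the
probability that `Γ_p` keeps less than a proportion `(1 - η / 2) p³` of these by
`exp (-c n³p³ / (1 + 3 n p²))`, and for `p ≥ (log n)^{1/3} n^{-2/3}` the exponent exceeds `4 n`, so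
that a union bound over at most `8 ^ n` triples suffices (`sum_exists_few_triangles_le`). Since
a large constant in place of `log n` would already give such an exponent, `C = 1` is enough.

Janson's inequality is proved for random subsets of a finite type with arbitrary inclusion
probabilities: Harris' inequality, an instance of the FKG inequality, gives a differential
inequality for the Laplace transform of the counting variable (`janson_deriv`).
-/

namespace TriangleFactor

/-! ### Janson's inequality for random subsets of a finite type -/

section RandomSubset

variable {α : Type*} [Fintype α] [DecidableEq α]

/-- The probability that a random subset of `α`, containing each `e` independently with
probability `q e`, equals `S`. -/
noncomputable def subsetWeight (q : α → ℝ) (S : Finset α) : ℝ :=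
  ∏ e, if e ∈ S then q e else 1 - q e

/-- The expectation of `f` at a random subset of `α` that contains each `e` independently with
probability `q e`. -/
noncomputable def subsetExp (q : α → ℝ) (f : Finset α → ℝ) : ℝ :=
  ∑ S, subsetWeight q S * f S

lemma subsetWeight_nonneg {q : α → ℝ} (h0 : ∀ e, 0 ≤ q e) (h1 : ∀ e, q e ≤ 1) (S : Finset α) :
    0 ≤ subsetWeight q S :=
  Finset.prod_nonneg fun e _ => by split_ifs <;> [exact h0 e; exact sub_nonneg.2 (h1 e)]

lemma sum_subsetWeight (q : α → ℝ) : ∑ S, subsetWeight q S = 1 := by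
  have h := Finset.prod_add q (fun e => 1 - q e) Finset.univ
  simp only [add_sub_cancel, Finset.prod_const_one, Finset.powerset_univ] at h
  rw [h]
  refine Finset.sum_congr rfl fun S _ => ?_
  rw [subsetWeight, Finset.prod_ite]
  congr 1
  · exact Finset.prod_congr (by ext; simp) fun _ _ => rfl
  · exact Finset.prod_congr (by ext; simp) fun _ _ => rfl

lemma subsetExp_mono {q : α → ℝ} (h0 : ∀ e, 0 ≤ q e) (h1 : ∀ e, q e ≤ 1)
    {f g : Finset α → ℝ} (h : ∀ S, f S ≤ g S) : subsetExp q f ≤ subsetExp q g :=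
  Finset.sum_le_sum fun S _ => mul_le_mul_of_nonneg_left (h S) (subsetWeight_nonneg h0 h1 S)

lemma subsetExp_const_mul (q : α → ℝ) (c : ℝ) (f : Finset α → ℝ) :
    subsetExp q (fun S => c * f S) = c * subsetExp q f := by
  simp only [subsetExp, Finset.mul_sum]
  exact Finset.sum_congr rfl fun S _ => by ring

lemma subsetExp_sum {ι : Type*} (q : α → ℝ) (I : Finset ι) (f : ι → Finset α → ℝ) :
    subsetExp q (fun S => ∑ i ∈ I, f i S) = ∑ i ∈ I, subsetExp q (f i) := by
  simp only [subsetExp, Finset.mul_sum]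
  exact Finset.sum_comm

/-- Harris' inequality for two decreasing functions: the product weight is log-modular, so this is
the FKG inequality on the order dual of `Finset α`. -/
lemma subsetExp_mul_le {q : α → ℝ} (h0 : ∀ e, 0 ≤ q e) (h1 : ∀ e, q e ≤ 1)
    {f g : Finset α → ℝ} (hf0 : ∀ S, 0 ≤ f S) (hg0 : ∀ S, 0 ≤ g S)
    (hf : Antitone f) (hg : Antitone g) :
    subsetExp q f * subsetExp q g ≤ subsetExp q (fun S => f S * g S) := by
  have h := fkg (α := (Finset α)ᵒᵈ) (μ := fun S => subsetWeight q (OrderDual.ofDual S))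
    (f := fun S => f (OrderDual.ofDual S)) (g := fun S => g (OrderDual.ofDual S))
    (fun S => subsetWeight_nonneg h0 h1 _) (fun S => hf0 _) (fun S => hg0 _)
    (fun a b hab => hf hab) (fun a b hab => hg hab) (fun a b => by
      apply le_of_eq
      simp only [subsetWeight, ← Finset.prod_mul_distrib, ofDual_inf, ofDual_sup]
      refine Finset.prod_congr rfl fun e _ => ?_
      by_cases ha : e ∈ OrderDual.ofDual a <;> by_cases hb : e ∈ OrderDual.ofDual b <;>
        simp [ha, hb, mul_comm])
  have hs : ∑ a : (Finset α)ᵒᵈ, subsetWeight q (OrderDual.ofDual a) = 1 := sum_subsetWeight q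
  rw [hs, one_mul] at h
  exact h

/-- Jensen's inequality for the exponential. -/
lemma exp_subsetExp_le {q : α → ℝ} (h0 : ∀ e, 0 ≤ q e) (h1 : ∀ e, q e ≤ 1) (f : Finset α → ℝ) :
    Real.exp (subsetExp q f) ≤ subsetExp q (fun S => Real.exp (f S)) := by
  have h := convexOn_exp.map_sum_le (t := Finset.univ) (w := subsetWeight q) (p := f)
    (fun S _ => subsetWeight_nonneg h0 h1 S) (sum_subsetWeight q) (fun _ _ => Set.mem_univ _)
  simpa [subsetExp, smul_eq_mul] using h

lemma subsetWeight_insert (q : α → ℝ) {e : α} {T : Finset α} (he : e ∉ T) :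
    subsetWeight q (insert e T) = q e * (subsetWeight q T + subsetWeight q (insert e T)) := by
  have key : ∀ S : Finset α, subsetWeight q S = (if e ∈ S then q e else 1 - q e) *
      ∏ x ∈ Finset.univ.erase e, if x ∈ S then q x else 1 - q x := fun S =>
    (Finset.mul_prod_erase _ _ (Finset.mem_univ e)).symm
  have h : (∏ x ∈ Finset.univ.erase e, if x ∈ insert e T then q x else 1 - q x) =
      ∏ x ∈ Finset.univ.erase e, if x ∈ T then q x else 1 - q x :=
    Finset.prod_congr rfl fun x hx => by simp [Finset.ne_of_mem_erase hx]
  rw [key (insert e T), key T, h]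
  simp only [Finset.mem_insert_self, if_true, he, if_false]
  ring

lemma subsetExp_indicator_mem (q : α → ℝ) (e : α) (f : Finset α → ℝ) :
    subsetExp q (fun S => if e ∈ S then f S else 0) = q e * subsetExp q fun S => f (insert e S) := by
  have hu : (Finset.univ : Finset (Finset α)) = (insert e (Finset.univ.erase e)).powerset := by
    rw [Finset.insert_erase (Finset.mem_univ e), Finset.powerset_univ]
  have he : e ∉ (Finset.univ : Finset α).erase e := Finset.notMem_erase _ _
  simp only [subsetExp]
  rw [hu, Finset.sum_powerset_insert he, Finset.sum_powerset_insert he, ← Finset.sum_add_distrib,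
    ← Finset.sum_add_distrib, Finset.mul_sum]
  refine Finset.sum_congr rfl fun T hT => ?_
  have heT : e ∉ T := fun h => he (Finset.mem_powerset.1 hT h)
  simp only [heT, if_false, Finset.mem_insert_self, if_true, Finset.insert_idem, mul_zero, zero_add]
  rw [← add_mul, ← mul_assoc, ← subsetWeight_insert q heT]

/-- Conditioning on `A ⊆ S` amounts to adding `A` to the random set. -/
lemma subsetExp_indicator_subset (q : α → ℝ) (A : Finset α) (f : Finset α → ℝ) :
    subsetExp q (fun S => if A ⊆ S then f S else 0) =
      (∏ e ∈ A, q e) * subsetExp q fun S => f (S ∪ A) := by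
  induction A using Finset.induction_on generalizing f with
  | empty => simp
  | insert e A he ih =>
    have h1 : (fun S => if insert e A ⊆ S then f S else 0) =
        fun S => if e ∈ S then (if A ⊆ S then f S else 0) else 0 := by
      funext S
      simp only [Finset.insert_subset_iff, ite_and]
    have h2 : ∀ S : Finset α, A ⊆ insert e S ↔ A ⊆ S := fun S =>
      Finset.subset_insert_iff_of_notMem he
    rw [h1, subsetExp_indicator_mem]
    simp only [h2]
    rw [ih, Finset.prod_insert he, mul_assoc]
    simp only [Finset.union_insert]

lemma subsetExp_subset (q : α → ℝ) (A : Finset α) :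
    subsetExp q (fun S => if A ⊆ S then 1 else 0) = ∏ e ∈ A, q e := by
  rw [subsetExp_indicator_subset]
  simp [subsetExp, sum_subsetWeight]

variable {ι : Type*}

/-- The number of members of the family `(A i)_{i ∈ I}` that are contained in `S`. -/
noncomputable def containedCount (I : Finset ι) (A : ι → Finset α) (S : Finset α) : ℝ :=
  ∑ i ∈ I, if A i ⊆ S then 1 else 0

/-- The differential inequality behind Janson's bound: with `φ s = E e^{-sX}` it says that
`-φ' s ≥ μ (1 - s D) φ s`. For each `i`, condition on `A i ⊆ S`, split `X` into the members meeting
`A i` and those disjoint from it, decouple the two by Harris' inequality, and use Jensen on the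
former and independence of the conditioning on the latter. -/
lemma janson_deriv {q : α → ℝ} (h0 : ∀ e, 0 ≤ q e) (h1 : ∀ e, q e ≤ 1)
    (I : Finset ι) (A : ι → Finset α) {D : ℝ}
    (hD : ∀ i ∈ I, ∑ j ∈ I with ¬ Disjoint (A j) (A i), ∏ e ∈ A j \ A i, q e ≤ D)
    {s : ℝ} (hs : 0 ≤ s) :
    (∑ i ∈ I, ∏ e ∈ A i, q e) * (1 - s * D) *
        subsetExp q (fun S => Real.exp (-s * containedCount I A S)) ≤
      subsetExp q (fun S => containedCount I A S * Real.exp (-s * containedCount I A S)) := by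
  have hR : subsetExp q (fun S => containedCount I A S * Real.exp (-s * containedCount I A S)) =
      ∑ i ∈ I, (∏ e ∈ A i, q e) *
        subsetExp q (fun S => Real.exp (-s * containedCount I A (S ∪ A i))) := by
    rw [← Finset.sum_congr rfl fun i _ => subsetExp_indicator_subset q (A i)
      fun S => Real.exp (-s * containedCount I A S), ← subsetExp_sum]
    congr 1
    funext S
    rw [containedCount, Finset.sum_mul]
    exact Finset.sum_congr rfl fun i _ => by split_ifs <;> simp
  rw [hR, Finset.sum_mul, Finset.sum_mul]
  refine Finset.sum_le_sum fun i hi => ?_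
  rw [mul_assoc]
  refine mul_le_mul_of_nonneg_left ?_ (Finset.prod_nonneg fun e _ => h0 e)
  set Y : Finset α → ℝ := fun S =>
    ∑ j ∈ I with ¬ Disjoint (A j) (A i), if A j ⊆ S ∪ A i then 1 else 0 with hY
  set Z : Finset α → ℝ := fun S =>
    ∑ j ∈ I with Disjoint (A j) (A i), if A j ⊆ S then 1 else 0 with hZ
  have hsplit : ∀ S, containedCount I A (S ∪ A i) = Y S + Z S := by
    intro S
    rw [containedCount, ← Finset.sum_filter_add_sum_filter_not I (fun j => Disjoint (A j) (A i)),
      add_comm]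
    congr 1
    refine Finset.sum_congr rfl fun j hj => ?_
    have hd := (Finset.mem_filter.1 hj).2
    have : A j ⊆ S ∪ A i ↔ A j ⊆ S :=
      ⟨fun h => hd.left_le_of_le_sup_right h, fun h => h.trans Finset.subset_union_left⟩
    simp only [this]
  have hZle : ∀ S, Z S ≤ containedCount I A S := fun S =>
    Finset.sum_le_sum_of_subset_of_nonneg (Finset.filter_subset _ _)
      fun _ _ _ => by split_ifs <;> norm_num
  have hYmono : Monotone Y := fun S T hST => Finset.sum_le_sum fun j _ => by
    by_cases h : A j ⊆ S ∪ A i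
    · rw [if_pos h, if_pos (h.trans (Finset.union_subset_union_left hST))]
    · rw [if_neg h]; split_ifs <;> norm_num
  have hZmono : Monotone Z := fun S T hST => Finset.sum_le_sum fun j _ => by
    by_cases h : A j ⊆ S
    · rw [if_pos h, if_pos (h.trans hST)]
    · rw [if_neg h]; split_ifs <;> norm_num
  have hanti : ∀ {W : Finset α → ℝ}, Monotone W → Antitone fun S => Real.exp (-s * W S) :=
    fun hW S T hST => Real.exp_le_exp.2 (by nlinarith [hW hST])
  have hEY : subsetExp q Y ≤ D := by
    refine le_trans (le_of_eq ?_) (hD i hi)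
    rw [hY, subsetExp_sum]
    refine Finset.sum_congr rfl fun j _ => ?_
    rw [← subsetExp_subset]
    have : ∀ S, A j \ A i ⊆ S ↔ A j ⊆ S ∪ A i := fun S => by
      rw [Finset.union_comm]
      exact sdiff_le_iff
    simp only [this]
  have hYexp : 1 - s * D ≤ subsetExp q fun S => Real.exp (-s * Y S) := by
    refine le_trans ?_ (exp_subsetExp_le h0 h1 _)
    rw [subsetExp_const_mul]
    refine le_trans ?_ (Real.add_one_le_exp _)
    nlinarith
  have hE0 : 0 ≤ subsetExp q (fun S => Real.exp (-s * containedCount I A S)) :=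
    Finset.sum_nonneg fun S _ => mul_nonneg (subsetWeight_nonneg h0 h1 S) (Real.exp_nonneg _)
  have hYexp0 : 0 ≤ subsetExp q fun S => Real.exp (-s * Y S) :=
    Finset.sum_nonneg fun S _ => mul_nonneg (subsetWeight_nonneg h0 h1 S) (Real.exp_nonneg _)
  calc (1 - s * D) * subsetExp q (fun S => Real.exp (-s * containedCount I A S))
      ≤ subsetExp q (fun S => Real.exp (-s * Y S)) *
          subsetExp q (fun S => Real.exp (-s * containedCount I A S)) :=
        mul_le_mul_of_nonneg_right hYexp hE0
    _ ≤ subsetExp q (fun S => Real.exp (-s * Y S)) *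
          subsetExp q (fun S => Real.exp (-s * Z S)) :=
        mul_le_mul_of_nonneg_left (subsetExp_mono h0 h1 fun S =>
          Real.exp_le_exp.2 (by nlinarith [hZle S])) hYexp0
    _ ≤ subsetExp q (fun S => Real.exp (-s * Y S) * Real.exp (-s * Z S)) :=
        subsetExp_mul_le h0 h1 (fun _ => Real.exp_nonneg _) (fun _ => Real.exp_nonneg _)
          (hanti hYmono) (hanti hZmono)
    _ = subsetExp q (fun S => Real.exp (-s * containedCount I A (S ∪ A i))) := by
        congr 1
        funext S
        rw [hsplit, ← Real.exp_add]
        ring_nf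

/-- Janson's bound on the Laplace transform of the number of members contained in a random set. -/
lemma janson_exp {q : α → ℝ} (h0 : ∀ e, 0 ≤ q e) (h1 : ∀ e, q e ≤ 1)
    (I : Finset ι) (A : ι → Finset α) {D : ℝ}
    (hD : ∀ i ∈ I, ∑ j ∈ I with ¬ Disjoint (A j) (A i), ∏ e ∈ A j \ A i, q e ≤ D)
    {s : ℝ} (hs : 0 ≤ s) :
    subsetExp q (fun S => Real.exp (-s * containedCount I A S)) ≤
      Real.exp (-((∑ i ∈ I, ∏ e ∈ A i, q e) * (s - s ^ 2 * D / 2))) := by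
  set μ := ∑ i ∈ I, ∏ e ∈ A i, q e with hμ
  set φ : ℝ → ℝ := fun s => subsetExp q (fun S => Real.exp (-s * containedCount I A S)) with hφ
  set ψ : ℝ → ℝ := fun s => subsetExp q (fun S =>
    containedCount I A S * Real.exp (-s * containedCount I A S)) with hψ
  have hderiv : ∀ s, HasDerivAt φ (-ψ s) s := by
    intro s
    have : -ψ s = ∑ S, subsetWeight q S *
        (Real.exp (-s * containedCount I A S) * (-1 * containedCount I A S)) := by
      simp only [hψ, subsetExp, ← Finset.sum_neg_distrib]
      exact Finset.sum_congr rfl fun S _ => by ring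
    rw [this]
    refine HasDerivAt.fun_sum fun S _ => HasDerivAt.const_mul _ ?_
    exact (((hasDerivAt_id s).neg.mul_const _).exp)
  have hpoly : ∀ s : ℝ, HasDerivAt (fun s : ℝ => Real.exp (μ * (s - s ^ 2 * D / 2)))
      (Real.exp (μ * (s - s ^ 2 * D / 2)) * (μ * (1 - s * D))) s := by
    intro s
    refine HasDerivAt.exp (HasDerivAt.const_mul _ ?_)
    have h := (hasDerivAt_id s).sub ((((hasDerivAt_id s).pow 2).mul_const D).div_const 2)
    refine h.congr_deriv ?_
    simp only [id]
    ring
  have hg : ∀ s, HasDerivAt (fun s => φ s * Real.exp (μ * (s - s ^ 2 * D / 2)))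
      (-ψ s * Real.exp (μ * (s - s ^ 2 * D / 2)) +
        φ s * (Real.exp (μ * (s - s ^ 2 * D / 2)) * (μ * (1 - s * D)))) s :=
    fun s => (hderiv s).mul (hpoly s)
  have hanti : AntitoneOn (fun s => φ s * Real.exp (μ * (s - s ^ 2 * D / 2))) (Set.Ici 0) := by
    refine antitoneOn_of_deriv_nonpos (convex_Ici 0)
      (fun x _ => (hg x).continuousAt.continuousWithinAt)
      (fun x _ => (hg x).differentiableAt.differentiableWithinAt) fun x hx => ?_
    rw [interior_Ici] at hx
    rw [(hg x).deriv]
    have h := janson_deriv h0 h1 I A hD (le_of_lt hx)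
    have : (μ * (1 - x * D) * φ x - ψ x) * Real.exp (μ * (x - x ^ 2 * D / 2)) ≤ 0 :=
      mul_nonpos_of_nonpos_of_nonneg (sub_nonpos.2 h) (Real.exp_nonneg _)
    linarith
  have h := hanti (Set.self_mem_Ici) (Set.mem_Ici.2 hs) hs
  have hφ0 : φ 0 = 1 := by simp [hφ, subsetExp, sum_subsetWeight]
  simp only [hφ0] at h
  rw [Real.exp_neg, ← one_div, le_div_iff₀ (Real.exp_pos _)]
  simpa only [hφ, ne_eq, OfNat.ofNat_ne_zero, not_false_eq_true, zero_pow, zero_mul, zero_div,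
    sub_zero, mul_zero, Real.exp_zero, mul_one] using h

/-- **Janson's inequality** for the lower tail, in the case where the expected number of members
meeting a given member, conditionally on the latter being present, is at most `D`. -/
lemma janson {q : α → ℝ} (h0 : ∀ e, 0 ≤ q e) (h1 : ∀ e, q e ≤ 1)
    (I : Finset ι) (A : ι → Finset α) {D c : ℝ} (hD0 : 0 < D) (hc : 0 ≤ c)
    (hD : ∀ i ∈ I, ∑ j ∈ I with ¬ Disjoint (A j) (A i), ∏ e ∈ A j \ A i, q e ≤ D) :
    ∑ S with containedCount I A S ≤ (1 - c) * ∑ i ∈ I, ∏ e ∈ A i, q e, subsetWeight q S ≤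
      Real.exp (-(c ^ 2 * (∑ i ∈ I, ∏ e ∈ A i, q e) / (2 * D))) := by
  set μ := ∑ i ∈ I, ∏ e ∈ A i, q e with hμ
  set s := c / D with hs
  have hs0 : 0 ≤ s := div_nonneg hc hD0.le
  -- Markov's inequality for `exp (-s X)` at the optimal `s = c / D`.
  have hle : ∑ S with containedCount I A S ≤ (1 - c) * μ, subsetWeight q S ≤
      Real.exp (s * ((1 - c) * μ)) *
        subsetExp q (fun S => Real.exp (-s * containedCount I A S)) := by
    rw [← subsetExp_const_mul, subsetExp, Finset.sum_filter]
    refine Finset.sum_le_sum fun S _ => ?_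
    split_ifs with h
    · refine le_mul_of_one_le_right (subsetWeight_nonneg h0 h1 S) ?_
      rw [← Real.exp_add]
      exact Real.one_le_exp (by nlinarith)
    · exact mul_nonneg (subsetWeight_nonneg h0 h1 S) (by positivity)
  refine hle.trans ((mul_le_mul_of_nonneg_left (janson_exp h0 h1 I A hD hs0)
    (Real.exp_nonneg _)).trans (le_of_eq ?_))
  rw [← Real.exp_add, ← hμ, hs]
  congr 1
  field_simp
  ring

end RandomSubset

/-! ### Triangles in the random subgraph -/

section Sparsification

variable {V : Type*}

open Classical in
/-- The probability with which the unordered pair `e` is an edge of `Γ_p`. -/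
noncomputable def edgeProb (Γ : SimpleGraph V) (p : ℝ) (e : Sym2 V) : ℝ :=
  if e ∈ Γ.edgeSet then p else 0

lemma edgeProb_nonneg (Γ : SimpleGraph V) {p : ℝ} (h0 : 0 ≤ p) (e : Sym2 V) :
    0 ≤ edgeProb Γ p e := by
  unfold edgeProb; split_ifs <;> [exact h0; exact le_rfl]

lemma edgeProb_le (Γ : SimpleGraph V) {p : ℝ} (h0 : 0 ≤ p) (e : Sym2 V) :
    edgeProb Γ p e ≤ p := by
  unfold edgeProb; split_ifs <;> [exact le_rfl; exact h0]

open Classical in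
/-- The triples in `X × Y × Z` that span a triangle of `G`. -/
noncomputable def crossTriangles (G : SimpleGraph V) (X Y Z : Finset V) : Finset (V × V × V) :=
  {v ∈ X ×ˢ Y ×ˢ Z | G.Adj v.1 v.2.1 ∧ G.Adj v.1 v.2.2 ∧ G.Adj v.2.1 v.2.2}

open Classical in
/-- The three pairs inside a triple of vertices. -/
noncomputable def triangleEdges (v : V × V × V) : Finset (Sym2 V) :=
  {s(v.1, v.2.1), s(v.1, v.2.2), s(v.2.1, v.2.2)}

lemma mem_crossTriangles {G : SimpleGraph V} {X Y Z : Finset V} {x y z : V} :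
    (x, y, z) ∈ crossTriangles G X Y Z ↔
      (x ∈ X ∧ y ∈ Y ∧ z ∈ Z) ∧ G.Adj x y ∧ G.Adj x z ∧ G.Adj y z := by
  simp [crossTriangles]

lemma prod_edgeProb_triangleEdges {Γ : SimpleGraph V} {p : ℝ} {X Y Z : Finset V}
    {v : V × V × V} (hv : v ∈ crossTriangles Γ X Y Z) :
    ∏ e ∈ triangleEdges v, edgeProb Γ p e = p ^ 3 := by
  obtain ⟨x, y, z⟩ := v
  obtain ⟨-, hxy, hxz, hyz⟩ := mem_crossTriangles.1 hv
  have h1 := hxy.ne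
  have h2 := hxz.ne
  have h3 := hyz.ne
  classical
  have hne1 : s(x, y) ∉ ({s(x, z), s(y, z)} : Finset (Sym2 V)) := by simp; grind
  have hne2 : s(x, z) ∉ ({s(y, z)} : Finset (Sym2 V)) := by simp [h1, h2]
  have : triangleEdges (x, y, z) = {s(x, y), s(x, z), s(y, z)} := by
    simp only [triangleEdges]
  rw [this, Finset.prod_insert hne1, Finset.prod_insert hne2, Finset.prod_singleton]
  simp only [edgeProb, SimpleGraph.mem_edgeSet, hxy, hxz, hyz, if_true]
  ring

open Classical in
lemma prod_edgeProb_le_sq (Γ : SimpleGraph V) {p : ℝ} (h0 : 0 ≤ p) (h1 : p ≤ 1)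
    {W : Finset (Sym2 V)} {e f : Sym2 V} (hef : e ≠ f) (he : e ∈ W) (hf : f ∈ W) :
    ∏ g ∈ W, edgeProb Γ p g ≤ p ^ 2 := by
  have hsub : ({e, f} : Finset (Sym2 V)) ⊆ W := by
    simp [Finset.insert_subset_iff, he, hf]
  rw [← Finset.prod_sdiff hsub, Finset.prod_pair hef]
  have h2 : ∏ g ∈ W \ {e, f}, edgeProb Γ p g ≤ 1 :=
    Finset.prod_le_one (fun g _ => edgeProb_nonneg Γ h0 g)
      fun g _ => (edgeProb_le Γ h0 g).trans h1
  have h3 : edgeProb Γ p e * edgeProb Γ p f ≤ p * p :=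
    mul_le_mul (edgeProb_le Γ h0 e) (edgeProb_le Γ h0 f) (edgeProb_nonneg Γ h0 f) h0
  calc _ ≤ 1 * (p * p) := mul_le_mul h2 h3
        (mul_nonneg (edgeProb_nonneg Γ h0 e) (edgeProb_nonneg Γ h0 f)) zero_le_one
    _ = p ^ 2 := by ring

open Classical in
/-- Two triangles that share an edge either coincide or differ in one vertex only, and then the
second one has two edges outside the first. -/
lemma prod_edgeProb_sdiff_le (Γ : SimpleGraph V) {p : ℝ} (h0 : 0 ≤ p) (h1 : p ≤ 1)
    {X Y Z : Finset V} (hXY : Disjoint X Y) (hXZ : Disjoint X Z) (hYZ : Disjoint Y Z)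
    {x y z a b c : V} (hx : x ∈ X) (hy : y ∈ Y) (hz : z ∈ Z) (ha : a ∈ X) (hb : b ∈ Y)
    (hc : c ∈ Z) (hd : ¬ Disjoint (triangleEdges (a, b, c)) (triangleEdges (x, y, z))) :
    ∏ e ∈ triangleEdges (a, b, c) \ triangleEdges (x, y, z), edgeProb Γ p e ≤
      (if (a, b, c) = (x, y, z) then 1 else 0) +
        p ^ 2 * ((if a = x ∧ b = y then 1 else 0) + (if a = x ∧ c = z then 1 else 0) +
          (if b = y ∧ c = z then 1 else 0)) := by
  have neXY : ∀ {u v}, u ∈ X → v ∈ Y → u ≠ v := fun hu hv => Finset.disjoint_iff_ne.1 hXY _ hu _ hv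
  have neXZ : ∀ {u v}, u ∈ X → v ∈ Z → u ≠ v := fun hu hv => Finset.disjoint_iff_ne.1 hXZ _ hu _ hv
  have neYZ : ∀ {u v}, u ∈ Y → v ∈ Z → u ≠ v := fun hu hv => Finset.disjoint_iff_ne.1 hYZ _ hu _ hv
  have e1 := neXY hx hy
  have e2 := neXZ hx hz
  have e3 := neYZ hy hz
  have e4 := neXY ha hb
  have e5 := neXZ ha hc
  have e6 := neYZ hb hc
  have e7 := neXY ha hy
  have e8 := neXZ ha hz
  have e9 := neYZ hb hz
  have e10 := neXY hx hb
  have e11 := neXZ hx hc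
  have e12 := neYZ hy hc
  have hp2 : 0 ≤ p ^ 2 := sq_nonneg p
  have hnn : ∀ (P : Prop) [Decidable P], (0 : ℝ) ≤ if P then 1 else 0 := fun P _ => by split_ifs <;> norm_num
  by_cases heq : (a, b, c) = (x, y, z)
  · rw [if_pos heq]
    refine (Finset.prod_le_one (fun g _ => edgeProb_nonneg Γ h0 g)
      fun g _ => (edgeProb_le Γ h0 g).trans h1).trans ?_
    have := mul_nonneg hp2 (add_nonneg (add_nonneg (hnn (a = x ∧ b = y)) (hnn (a = x ∧ c = z)))
      (hnn (b = y ∧ c = z)))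
    linarith
  have hcase : (a = x ∧ b = y) ∨ (a = x ∧ c = z) ∨ (b = y ∧ c = z) := by
    obtain ⟨e, he, he'⟩ := Finset.not_disjoint_iff.1 hd
    simp only [triangleEdges, Finset.mem_insert, Finset.mem_singleton] at he he'
    rcases he with rfl | rfl | rfl <;> rcases he' with h | h | h <;>
      simp only [Sym2.eq_iff] at h <;> grind
  rw [if_neg heq, zero_add]
  refine le_trans (b := p ^ 2 * 1) ?_ (mul_le_mul_of_nonneg_left ?_ hp2)
  · rw [mul_one]
    simp only [Prod.mk.injEq] at heq
    rcases hcase with ⟨rfl, rfl⟩ | ⟨rfl, rfl⟩ | ⟨rfl, rfl⟩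
    · refine prod_edgeProb_le_sq Γ h0 h1 (e := s(a, c)) (f := s(b, c)) ?_ ?_ ?_ <;>
        simp [triangleEdges] <;> grind
    · refine prod_edgeProb_le_sq Γ h0 h1 (e := s(a, b)) (f := s(b, c)) ?_ ?_ ?_ <;>
        simp [triangleEdges] <;> grind
    · refine prod_edgeProb_le_sq Γ h0 h1 (e := s(a, b)) (f := s(a, c)) ?_ ?_ ?_ <;>
        simp [triangleEdges] <;> grind
  · have n1 := hnn (a = x ∧ b = y)
    have n2 := hnn (a = x ∧ c = z)
    have n3 := hnn (b = y ∧ c = z)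
    rcases hcase with h | h | h
    · rw [if_pos h]; linarith
    · rw [if_pos h]; linarith
    · rw [if_pos h]; linarith

variable [Fintype V]

open Classical in
lemma setBernoulli_real_eq_sum (Γ : SimpleGraph V) (p : unitInterval)
    (B : Set (Set (Sym2 V))) :
    (setBernoulli Γ.edgeSet p).real B =
      ∑ S ∈ Finset.univ.filter (fun S : Finset (Sym2 V) => (S : Set (Sym2 V)) ∈ B),
        subsetWeight (edgeProb Γ p) S := by
  have hB : B = ((Finset.univ.filter fun S : Finset (Sym2 V) => (S : Set (Sym2 V)) ∈ B).image
      (fun S : Finset (Sym2 V) => (S : Set (Sym2 V))) : Finset (Set (Sym2 V))) := by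
    ext T
    simp only [Finset.coe_image, Finset.coe_filter, Finset.mem_univ, true_and, Set.mem_image,
      Set.mem_ofPred_eq]
    exact ⟨fun h => ⟨T.toFinset, by simpa using h, by simp⟩, by rintro ⟨S, hS, rfl⟩; exact hS⟩
  conv_lhs => rw [hB]
  rw [← sum_measureReal_singleton, Finset.sum_image (fun _ _ _ _ h => Finset.coe_injective h)]
  refine Finset.sum_congr rfl fun S _ => ?_
  by_cases hS : (S : Set (Sym2 V)) ⊆ Γ.edgeSet
  · rw [setBernoulli_real_singleton p hS (Set.toFinite _), subsetWeight, Finset.prod_ite]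
    congr 1
    · rw [Finset.prod_congr rfl (g := fun _ => (p : ℝ))]
      · rw [Finset.prod_const, Set.ncard_coe_finset]
        congr 2
        ext; simp
      · intro e he
        exact if_pos (hS (Finset.mem_filter.1 he).2)
    · simp only [edgeProb]
      rw [← Finset.prod_subset (s₁ := (Γ.edgeSet \ S).toFinset)]
      · rw [Finset.prod_congr rfl (g := fun _ => (1 - p : ℝ))]
        · rw [Finset.prod_const, Set.ncard_eq_toFinset_card']
        · intro e he
          rw [if_pos (Set.mem_toFinset.1 he).1]
      · intro e he
        simpa using (Set.mem_toFinset.1 he).2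
      · intro e he he'
        have h1 : e ∉ S := (Finset.mem_filter.1 he).2
        have h2 : e ∉ Γ.edgeSet := fun h => he' (Set.mem_toFinset.2 ⟨h, h1⟩)
        rw [if_neg h2, sub_zero]
  · rw [measureReal_def, setBernoulli_singleton_of_not_subset p hS, ENNReal.toReal_zero]
    obtain ⟨e, heS, heΓ⟩ := Set.not_subset.1 hS
    refine (Finset.prod_eq_zero (Finset.mem_univ e) ?_).symm
    rw [if_pos (Finset.mem_coe.1 heS), edgeProb, if_neg heΓ]

open Classical in
/-- An inequality is enough for lower bounds on probabilities, and it holds without measurability of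
the event `good`. -/
lemma one_sub_sum_le_sparsification (Γ : SimpleGraph V) (p : unitInterval)
    (good : SimpleGraph V → Prop) :
    1 - ∑ S ∈ Finset.univ.filter
      (fun S : Finset (Sym2 V) => ¬ good (SimpleGraph.fromEdgeSet (S : Set (Sym2 V)))),
        subsetWeight (edgeProb Γ p) S ≤ (sparsification Γ p).real {G | good G} := by
  have h1 : (setBernoulli Γ.edgeSet p).real (SimpleGraph.fromEdgeSet ⁻¹' {G | good G}) ≤
      (sparsification Γ p).real {G | good G} := by
    have : IsProbabilityMeasure (sparsification Γ p) :=
      Measure.isProbabilityMeasure_map SimpleGraph.measurable_fromEdgeSet.aemeasurable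
    exact ENNReal.toReal_mono (measure_ne_top _ _)
      (Measure.le_map_apply SimpleGraph.measurable_fromEdgeSet.aemeasurable _)
  have h2 := setBernoulli_real_eq_sum Γ p (SimpleGraph.fromEdgeSet ⁻¹' {G | good G})ᶜ
  rw [probReal_compl_eq_one_sub (Set.toFinite _).measurableSet] at h2
  simp only [Set.mem_compl_iff, Set.mem_preimage, Set.mem_ofPred_eq] at h2
  rw [← h2]
  linarith

open Classical in
/-- The lower tail of the number of triangles of `Γ_p` in `X × Y × Z`. In Janson's inequality one
may take `D = 1 + 3 n p ^ 2`: a triangle shares an edge with itself and with at most `n` others for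
each of its three edges. -/
lemma crossTriangles_lower_tail (Γ : SimpleGraph V) {p : ℝ} (h0 : 0 ≤ p) (h1 : p ≤ 1)
    {X Y Z : Finset V} (hXY : Disjoint X Y) (hXZ : Disjoint X Z) (hYZ : Disjoint Y Z) {n : ℝ}
    (hX : (X.card : ℝ) ≤ n) (hY : (Y.card : ℝ) ≤ n) (hZ : (Z.card : ℝ) ≤ n)
    {c : ℝ} (hc : 0 ≤ c) :
    ∑ S ∈ Finset.univ.filter (fun S : Finset (Sym2 V) =>
        ((crossTriangles (SimpleGraph.fromEdgeSet (S : Set (Sym2 V))) X Y Z).card : ℝ) ≤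
          (1 - c) * (p ^ 3 * (crossTriangles Γ X Y Z).card)), subsetWeight (edgeProb Γ p) S ≤
      Real.exp (-(c ^ 2 * (p ^ 3 * (crossTriangles Γ X Y Z).card) / (2 * (1 + 3 * n * p ^ 2)))) := by
  have hn : 0 ≤ n := (Nat.cast_nonneg _).trans hX
  have hμ : ∑ v ∈ crossTriangles Γ X Y Z, ∏ e ∈ triangleEdges v, edgeProb Γ p e =
      p ^ 3 * (crossTriangles Γ X Y Z).card := by
    rw [Finset.sum_congr rfl fun v hv => prod_edgeProb_triangleEdges hv, Finset.sum_const,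
      nsmul_eq_mul, mul_comm]
  have hD : ∀ v ∈ crossTriangles Γ X Y Z, ∑ w ∈ crossTriangles Γ X Y Z with
      ¬ Disjoint (triangleEdges w) (triangleEdges v),
        ∏ e ∈ triangleEdges w \ triangleEdges v, edgeProb Γ p e ≤ 1 + 3 * n * p ^ 2 := by
    rintro ⟨x, y, z⟩ hv
    obtain ⟨⟨hx, hy, hz⟩, -⟩ := mem_crossTriangles.1 hv
    have hstep : ∀ w ∈ (crossTriangles Γ X Y Z).filter fun w =>
        ¬ Disjoint (triangleEdges w) (triangleEdges (x, y, z)),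
        ∏ e ∈ triangleEdges w \ triangleEdges (x, y, z), edgeProb Γ p e ≤
          (if w = (x, y, z) then 1 else 0) +
        p ^ 2 * ((if w.1 = x ∧ w.2.1 = y then 1 else 0) + (if w.1 = x ∧ w.2.2 = z then 1 else 0) +
          (if w.2.1 = y ∧ w.2.2 = z then 1 else 0)) := by
      rintro ⟨a, b, c⟩ hw
      obtain ⟨hw1, hw2⟩ := Finset.mem_filter.1 hw
      obtain ⟨⟨ha, hb, hc⟩, -⟩ := mem_crossTriangles.1 hw1
      exact prod_edgeProb_sdiff_le Γ h0 h1 hXY hXZ hYZ hx hy hz ha hb hc hw2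
    have hnn : ∀ (P : Prop) [Decidable P], (0 : ℝ) ≤ if P then 1 else 0 := fun P _ => by split_ifs <;> norm_num
    refine (Finset.sum_le_sum hstep).trans ((Finset.sum_le_sum_of_subset_of_nonneg
      (t := X ×ˢ Y ×ˢ Z) ?_ fun w _ _ => ?_).trans ?_)
    · exact (Finset.filter_subset _ _).trans (Finset.filter_subset _ _)
    · exact add_nonneg (hnn _) (mul_nonneg (sq_nonneg p)
        (add_nonneg (add_nonneg (hnn _) (hnn _)) (hnn _)))
    · rw [Finset.sum_add_distrib, ← Finset.mul_sum, Finset.sum_add_distrib,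
        Finset.sum_add_distrib]
      simp only [Finset.sum_boole]
      have c0 : (((X ×ˢ Y ×ˢ Z).filter fun w => w = (x, y, z)).card : ℝ) ≤ 1 := by
        have : (X ×ˢ Y ×ˢ Z).filter (fun w => w = (x, y, z)) ⊆ {(x, y, z)} := fun w hw => by
          simpa using (Finset.mem_filter.1 hw).2
        exact_mod_cast (Finset.card_le_card this).trans (by simp)
      have c1 : (((X ×ˢ Y ×ˢ Z).filter fun w => w.1 = x ∧ w.2.1 = y).card : ℝ) ≤ n := by
        refine le_trans ?_ hZ
        have : (X ×ˢ Y ×ˢ Z).filter (fun w => w.1 = x ∧ w.2.1 = y) ⊆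
            Z.image fun c => (x, y, c) := by
          rintro ⟨a, b, c⟩ hw
          simp only [Finset.mem_filter, Finset.mem_product] at hw
          obtain ⟨⟨-, -, hc⟩, rfl, rfl⟩ := hw
          exact Finset.mem_image_of_mem _ hc
        exact_mod_cast (Finset.card_le_card this).trans Finset.card_image_le
      have c2 : (((X ×ˢ Y ×ˢ Z).filter fun w => w.1 = x ∧ w.2.2 = z).card : ℝ) ≤ n := by
        refine le_trans ?_ hY
        have : (X ×ˢ Y ×ˢ Z).filter (fun w => w.1 = x ∧ w.2.2 = z) ⊆
            Y.image fun b => (x, b, z) := by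
          rintro ⟨a, b, c⟩ hw
          simp only [Finset.mem_filter, Finset.mem_product] at hw
          obtain ⟨⟨-, hb, -⟩, rfl, rfl⟩ := hw
          exact Finset.mem_image_of_mem _ hb
        exact_mod_cast (Finset.card_le_card this).trans Finset.card_image_le
      have c3 : (((X ×ˢ Y ×ˢ Z).filter fun w => w.2.1 = y ∧ w.2.2 = z).card : ℝ) ≤ n := by
        refine le_trans ?_ hX
        have : (X ×ˢ Y ×ˢ Z).filter (fun w => w.2.1 = y ∧ w.2.2 = z) ⊆
            X.image fun a => (a, y, z) := by
          rintro ⟨a, b, c⟩ hw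
          simp only [Finset.mem_filter, Finset.mem_product] at hw
          obtain ⟨⟨ha, -, -⟩, rfl, rfl⟩ := hw
          exact Finset.mem_image_of_mem _ ha
        exact_mod_cast (Finset.card_le_card this).trans Finset.card_image_le
      nlinarith [mul_le_mul_of_nonneg_left (add_le_add (add_le_add c1 c2) c3) (sq_nonneg p)]
  have hJ := janson (edgeProb_nonneg Γ h0) (fun e => (edgeProb_le Γ h0 e).trans h1)
    (crossTriangles Γ X Y Z) triangleEdges (D := 1 + 3 * n * p ^ 2) (by positivity) hc hD
  rw [hμ] at hJ
  refine le_trans (Finset.sum_le_sum_of_subset_of_nonneg ?_ fun S _ _ =>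
    subsetWeight_nonneg (edgeProb_nonneg Γ h0) (fun e => (edgeProb_le Γ h0 e).trans h1) S) hJ
  intro S hS
  rw [Finset.mem_filter] at hS ⊢
  refine ⟨Finset.mem_univ _, le_trans ?_ hS.2⟩
  rw [containedCount, Finset.sum_boole]
  refine Nat.cast_le.2 (Finset.card_le_card ?_)
  rintro ⟨x, y, z⟩ hv
  obtain ⟨hv1, hv2⟩ := Finset.mem_filter.1 hv
  obtain ⟨hmem, hxy, hxz, hyz⟩ := mem_crossTriangles.1 hv1
  simp only [triangleEdges, Finset.insert_subset_iff, Finset.singleton_subset_iff] at hv2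
  refine mem_crossTriangles.2 ⟨hmem, ?_, ?_, ?_⟩ <;> rw [SimpleGraph.fromEdgeSet_adj]
  · exact ⟨hv2.1, hxy.ne⟩
  · exact ⟨hv2.2.1, hxz.ne⟩
  · exact ⟨hv2.2.2, hyz.ne⟩

end Sparsification

/-! ### The triangle counting lemma -/

section Counting

variable {V : Type*}

open Classical in
/-- In an `ε`-uniform pair of density `d`, few vertices of a set `X` have degree less than
`(d - ε) |Y|` into a given large set `Y`. -/
lemma card_low_degree_le {Γ : SimpleGraph V} {A B X Y : Finset V} {ε d : ℝ}
    (hAB : IsRegularPair Γ ε d A B) (hX : X ⊆ A) (hY : Y ⊆ B) (hεd : ε ≤ d)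
    (hYcard : (B.card : ℝ) * ε ≤ Y.card) :
    (({x ∈ X | (({y ∈ Y | Γ.Adj x y} : Finset V).card : ℝ) < (d - ε) * Y.card} : Finset V).card : ℝ)
      ≤ A.card * ε := by
  set U : Finset V := {x ∈ X | (({y ∈ Y | Γ.Adj x y} : Finset V).card : ℝ) < (d - ε) * Y.card}
    with hU
  by_contra! h
  have h1 := hAB.1 ((Finset.filter_subset _ X).trans hX : U ⊆ A) hY h.le hYcard
  rw [hAB.2, abs_lt] at h1
  have h2 : (Γ.edgeDensity U Y : ℝ) ≤ d - ε := by
    rw [SimpleGraph.edgeDensity_def]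
    push_cast
    refine div_le_of_le_mul₀ (by positivity) (sub_nonneg.2 hεd) ?_
    have h3 : ((SimpleGraph.interedges Γ U Y).card : ℝ) =
        ∑ x ∈ U, (({y ∈ Y | Γ.Adj x y} : Finset V).card : ℝ) := by
      rw [SimpleGraph.interedges, Rel.interedges, Finset.card_filter, Finset.sum_product]
      push_cast
      refine Finset.sum_congr rfl fun x _ => ?_
      rw [Finset.sum_boole]
    rw [h3]
    refine (Finset.sum_le_card_nsmul U _ ((d - ε) * Y.card) fun x hx =>
      (Finset.mem_filter.1 hx).2.le).trans (le_of_eq ?_)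
    rw [nsmul_eq_mul]
    ring
  linarith [h1.1]

open Classical in
/-- The triangle counting lemma inside large subsets of an `(ε, d)`-regular triple. A vertex of
`X` of typical degree into `Y` and `Z` has neighbourhoods large enough for the density between
them to be at least `d - ε`. -/
lemma mul_pow_le_card_crossTriangles {Γ : SimpleGraph V} {A B C X Y Z : Finset V} {ε d n m : ℝ}
    (hAB : IsRegularPair Γ ε d A B) (hAC : IsRegularPair Γ ε d A C)
    (hBC : IsRegularPair Γ ε d B C) (hA : (A.card : ℝ) = n) (hB : (B.card : ℝ) = n)
    (hC : (C.card : ℝ) = n) (hXA : X ⊆ A) (hYB : Y ⊆ B) (hZC : Z ⊆ C) (hX : (X.card : ℝ) = m)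
    (hY : (Y.card : ℝ) = m) (hZ : (Z.card : ℝ) = m) (hεd : ε ≤ d) (hm : n * ε ≤ m)
    (hdm : n * ε ≤ (d - ε) * m) :
    (m - 2 * (n * ε)) * ((d - ε) ^ 3 * m ^ 2) ≤ ((crossTriangles Γ X Y Z).card : ℝ) := by
  have hm0 : 0 ≤ m := hX ▸ Nat.cast_nonneg _
  have hde : 0 ≤ d - ε := sub_nonneg.2 hεd
  set U : Finset V := {x ∈ X | (({y ∈ Y | Γ.Adj x y} : Finset V).card : ℝ) < (d - ε) * Y.card}
    with hU
  set W : Finset V := {x ∈ X | (({y ∈ Z | Γ.Adj x y} : Finset V).card : ℝ) < (d - ε) * Z.card}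
    with hW
  have hUc : (U.card : ℝ) ≤ n * ε := by
    rw [← hA]
    exact card_low_degree_le hAB hXA hYB hεd (by rw [hB, hY]; exact hm)
  have hWc : (W.card : ℝ) ≤ n * ε := by
    rw [← hA]
    exact card_low_degree_le hAC hXA hZC hεd (by rw [hC, hZ]; exact hm)
  have hgood : m - 2 * (n * ε) ≤ ((X \ (U ∪ W)).card : ℝ) := by
    have h1 : (X.card : ℝ) ≤ (X \ (U ∪ W)).card + (U ∪ W).card := by
      exact_mod_cast Finset.card_le_card_sdiff_add_card
    have h2 : ((U ∪ W).card : ℝ) ≤ U.card + W.card := by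
      exact_mod_cast Finset.card_union_le _ _
    linarith
  have hcount : ((crossTriangles Γ X Y Z).card : ℝ) =
      ∑ x ∈ X, ((Γ.interedges {y ∈ Y | Γ.Adj x y} {z ∈ Z | Γ.Adj x z}).card : ℝ) := by
    rw [crossTriangles, Finset.card_filter, Finset.sum_product]
    push_cast
    refine Finset.sum_congr rfl fun x _ => ?_
    rw [Finset.sum_boole]
    congr 2
    ext ⟨y, z⟩
    simp only [Finset.mem_filter, Finset.mem_product, SimpleGraph.mem_interedges_iff]
    tauto
  rw [hcount]
  refine le_trans ?_ (Finset.sum_le_sum_of_subset_of_nonneg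
    (Finset.sdiff_subset : X \ (U ∪ W) ⊆ X) fun _ _ _ => Nat.cast_nonneg _)
  refine le_trans ?_ (Finset.card_nsmul_le_sum (X \ (U ∪ W)) _ ((d - ε) ^ 3 * m ^ 2) fun x hx => ?_)
  · rw [nsmul_eq_mul]
    exact mul_le_mul_of_nonneg_right hgood (by positivity)
  · rw [Finset.mem_sdiff, Finset.mem_union, not_or, hU, hW, Finset.mem_filter, Finset.mem_filter,
      not_and, not_and, not_lt, not_lt, hY, hZ] at hx
    have hNY := hx.2.1 hx.1
    have hNZ := hx.2.2 hx.1
    set NY : Finset V := {y ∈ Y | Γ.Adj x y}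
    set NZ : Finset V := {z ∈ Z | Γ.Adj x z}
    have h1 := hBC.1 ((Finset.filter_subset _ Y).trans hYB : NY ⊆ B)
      ((Finset.filter_subset _ Z).trans hZC : NZ ⊆ C) (by rw [hB]; linarith) (by rw [hC]; linarith)
    rw [hBC.2, abs_lt] at h1
    have h2 : d - ε ≤ (Γ.edgeDensity NY NZ : ℝ) := by linarith [h1.1]
    rw [SimpleGraph.edgeDensity_def] at h2
    push_cast at h2
    refine le_trans ?_ (mul_le_of_le_div₀ (Nat.cast_nonneg _) (by positivity) h2)
    calc (d - ε) ^ 3 * m ^ 2 = (d - ε) * (((d - ε) * m) * ((d - ε) * m)) := by ring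
      _ ≤ (d - ε) * (NY.card * NZ.card) := by gcongr

/-- With `ε = η² d / 10`, all triples of equally large subsets of relative size at least `η` span
at least `(1 - η / 2) d³ m³` triangles. -/
lemma le_card_crossTriangles {Γ : SimpleGraph V} {P : Fin 3 → Finset V} {η d n m : ℝ}
    (hη : 0 < η) (hη' : η ≤ 1) (hd : 0 < d) (hd' : d ≤ 1)
    (hΓ : IsRegularTripartite Γ P (η ^ 2 * d / 10) d) (hP : ∀ i, ((P i).card : ℝ) = n)
    {X Y Z : Finset V} (hXA : X ⊆ P 0) (hYB : Y ⊆ P 1) (hZC : Z ⊆ P 2) (hX : (X.card : ℝ) = m)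
    (hY : (Y.card : ℝ) = m) (hZ : (Z.card : ℝ) = m) (hm : η * n ≤ m) :
    (1 - η / 2) * (d ^ 3 * m ^ 3) ≤ ((crossTriangles Γ X Y Z).card : ℝ) := by
  have hn0 : 0 ≤ n := hP 0 ▸ Nat.cast_nonneg _
  have hm0 : 0 ≤ m := (mul_nonneg hη.le hn0).trans hm
  have hη2 : η ^ 2 ≤ 1 := pow_le_one₀ hη.le hη'
  set ε := η ^ 2 * d / 10 with hε
  have hεd : ε ≤ d := by rw [hε]; nlinarith
  have hnε : n * ε ≤ η * d / 10 * m := by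
    calc n * ε = η * d / 10 * (η * n) := by rw [hε]; ring
      _ ≤ _ := mul_le_mul_of_nonneg_left hm (by positivity)
  have hdε : (1 - η / 10) * d ≤ d - ε := by
    rw [hε]; nlinarith [mul_nonneg hη.le (sub_nonneg.2 hη'), mul_pos hη hd,
      mul_nonneg (mul_nonneg hη.le (sub_nonneg.2 hη')) hd.le]
  have hdm0 : 0 ≤ d * m := by positivity
  have hdm : n * ε ≤ (d - ε) * m := by
    calc n * ε ≤ η * d / 10 * m := hnε
      _ = η / 10 * (d * m) := by ring
      _ ≤ (1 - η / 10) * (d * m) := mul_le_mul_of_nonneg_right (by linarith) hdm0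
      _ = (1 - η / 10) * d * m := by ring
      _ ≤ (d - ε) * m := mul_le_mul_of_nonneg_right hdε hm0
  refine le_trans ?_ (mul_pow_le_card_crossTriangles (hΓ.2 0 1 (by decide)) (hΓ.2 0 2 (by decide))
    (hΓ.2 1 2 (by decide)) (hP 0) (hP 1) (hP 2) hXA hYB hZC hX hY hZ hεd ?_ hdm)
  · have h1 : (1 - η / 5) * m ≤ m - 2 * (n * ε) := by
      have : η * d / 10 * m ≤ η / 10 * m :=
        mul_le_mul_of_nonneg_right (by nlinarith) hm0
      linarith
    have h2 : (1 - η / 10) ^ 3 * d ^ 3 ≤ (d - ε) ^ 3 := by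
      rw [← mul_pow]
      exact pow_le_pow_left₀ (mul_nonneg (by linarith) hd.le) hdε 3
    have h3 : 1 - 3 * η / 10 ≤ (1 - η / 10) ^ 3 := by
      have := one_add_mul_le_pow (a := -(η / 10)) (by linarith) 3
      refine le_trans (le_of_eq ?_) (this.trans (le_of_eq ?_)) <;> push_cast <;> ring
    have h4 : 1 - η / 2 ≤ (1 - η / 5) * (1 - η / 10) ^ 3 := by
      nlinarith [mul_le_mul_of_nonneg_left h3 (show 0 ≤ 1 - η / 5 by linarith), sq_nonneg η]
    calc (1 - η / 2) * (d ^ 3 * m ^ 3)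
        ≤ (1 - η / 5) * (1 - η / 10) ^ 3 * (d ^ 3 * m ^ 3) :=
          mul_le_mul_of_nonneg_right h4 (by positivity)
      _ = ((1 - η / 5) * m) * ((1 - η / 10) ^ 3 * d ^ 3 * m ^ 2) := by ring
      _ ≤ (m - 2 * (n * ε)) * ((d - ε) ^ 3 * m ^ 2) := by
          have h5 : 0 ≤ (1 - η / 5) * m := mul_nonneg (by linarith) hm0
          have h6 : 0 ≤ (1 - η / 10) ^ 3 * d ^ 3 * m ^ 2 :=
            mul_nonneg (mul_nonneg (pow_nonneg (by linarith) 3) (by positivity)) (by positivity)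
          exact mul_le_mul h1 (mul_le_mul_of_nonneg_right h2 (by positivity)) h6 (h5.trans h1)
  · calc n * ε ≤ η * d / 10 * m := hnε
      _ ≤ 1 * m := mul_le_mul_of_nonneg_right (by nlinarith) hm0
      _ = m := one_mul m

end Counting

/-! ### Greedy embedding of disjoint triangles -/

section Embeddings

variable {V : Type*} [Fintype V]

open Classical in
/-- Sequences of `t` vertex-disjoint triangles of `G`, each given as a triple in
`P 0 × P 1 × P 2`. -/
noncomputable def disjointTriangleSeqs (P : Fin 3 → Finset V) (G : SimpleGraph V) (t : ℕ) :
    Finset (Fin t → V × V × V) :=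
  {f | (∀ s, f s ∈ crossTriangles G (P 0) (P 1) (P 2)) ∧
    Function.Injective (fun s => (f s).1) ∧ Function.Injective (fun s => (f s).2.1) ∧
      Function.Injective (fun s => (f s).2.2)}

open Classical in
lemma card_disjointTriangleSeqs_le_ncard {P : Fin 3 → Finset V}
    (hP : ∀ i j, i ≠ j → Disjoint (P i) (P j)) (G : SimpleGraph V) (t : ℕ) :
    (disjointTriangleSeqs P G t).card ≤ (triangleEmbeddings P t G).ncard := by
  have hfin : (triangleEmbeddings P t G).Finite :=
    haveI : Finite (SimpleGraph.Copy (disjointTriangles t) G) :=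
      Finite.of_injective (fun ψ => (ψ : Fin t × Fin 3 → V)) DFunLike.coe_injective
    Set.toFinite _
  set g : SimpleGraph.Copy (disjointTriangles t) G → (Fin t → V × V × V) :=
    fun ψ s => (ψ (s, 0), ψ (s, 1), ψ (s, 2)) with hg
  have hsub : (disjointTriangleSeqs P G t : Set (Fin t → V × V × V)) ⊆
      g '' triangleEmbeddings P t G := by
    intro f hf
    obtain ⟨-, hT, h0, h1, h2⟩ := Finset.mem_filter.1 (Finset.mem_coe.1 hf)
    set φ : Fin t × Fin 3 → V := fun x => ![(f x.1).1, (f x.1).2.1, (f x.1).2.2] x.2 with hφ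
    have hmem : ∀ s i, φ (s, i) ∈ P i := by
      intro s i
      have := (mem_crossTriangles.1 (hT s)).1
      fin_cases i <;> simp [hφ, this]
    have hadj : ∀ s i j, i ≠ j → G.Adj (φ (s, i)) (φ (s, j)) := by
      intro s i j hij
      have := (mem_crossTriangles.1 (hT s)).2
      fin_cases i <;> fin_cases j <;> simp_all [G.adj_comm]
    have hinj : Function.Injective φ := by
      rintro ⟨s, i⟩ ⟨s', j⟩ h
      have hij : i = j := by
        by_contra hne
        exact Finset.disjoint_left.1 (hP i j hne) (hmem s i) (h ▸ hmem s' j)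
      subst hij
      have : s = s' := by
        fin_cases i
        · exact h0 h
        · exact h1 h
        · exact h2 h
      rw [this]
    refine ⟨⟨⟨φ, ?_⟩, hinj⟩, hmem, rfl⟩
    rintro ⟨s, i⟩ ⟨s', j⟩ ⟨h, hij⟩
    obtain rfl : s = s' := h
    exact hadj s i j hij
  calc (disjointTriangleSeqs P G t).card
      = (disjointTriangleSeqs P G t : Set (Fin t → V × V × V)).ncard :=
        (Set.ncard_coe_finset _).symm
    _ ≤ (g '' triangleEmbeddings P t G).ncard := Set.ncard_le_ncard hsub (hfin.image g)
    _ ≤ (triangleEmbeddings P t G).ncard := Set.ncard_image_le hfin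

open Classical in
lemma mul_card_disjointTriangleSeqs_le {P : Fin 3 → Finset V} {G : SimpleGraph V} {t : ℕ} {K : ℝ}
    (hK : ∀ f ∈ disjointTriangleSeqs P G t, K ≤ ((crossTriangles G
      (P 0 \ Finset.univ.image fun s => (f s).1) (P 1 \ Finset.univ.image fun s => (f s).2.1)
      (P 2 \ Finset.univ.image fun s => (f s).2.2)).card : ℝ)) :
    (disjointTriangleSeqs P G t).card * K ≤ (disjointTriangleSeqs P G (t + 1)).card := by
  set R : (Fin t → V × V × V) → Finset (V × V × V) := fun f => crossTriangles G
      (P 0 \ Finset.univ.image fun s => (f s).1) (P 1 \ Finset.univ.image fun s => (f s).2.1)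
      (P 2 \ Finset.univ.image fun s => (f s).2.2) with hR
  have hle : ((disjointTriangleSeqs P G t).sigma R).card ≤
      (disjointTriangleSeqs P G (t + 1)).card := by
    refine Finset.card_le_card_of_injOn
      (fun x => (Fin.cons x.2 x.1 : Fin (t + 1) → V × V × V)) ?_ ?_
    · rintro ⟨f, x, y, z⟩ h
      obtain ⟨hf, hv⟩ := Finset.mem_sigma.1 (Finset.mem_coe.1 h)
      obtain ⟨-, hT, h0, h1, h2⟩ := Finset.mem_filter.1 hf
      obtain ⟨⟨hx, hy, hz⟩, hadj⟩ := mem_crossTriangles.1 hv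
      simp only [Finset.mem_sdiff, Finset.mem_image, Finset.mem_univ, true_and,
        not_exists] at hx hy hz
      refine Finset.mem_coe.2 (Finset.mem_filter.2 ⟨Finset.mem_univ _, ?_, ?_, ?_, ?_⟩)
      · refine Fin.cases ?_ fun s => ?_
        · exact mem_crossTriangles.2 ⟨⟨hx.1, hy.1, hz.1⟩, hadj⟩
        · exact hT s
      all_goals
        intro a b
        refine Fin.cases ?_ (fun a => ?_) a <;> refine Fin.cases ?_ (fun b => ?_) b
      · simp
      · exact fun h => (hx.2 b h.symm).elim
      · exact fun h => (hx.2 a h).elim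
      · exact fun h => congrArg Fin.succ (h0 h)
      · simp
      · exact fun h => (hy.2 b h.symm).elim
      · exact fun h => (hy.2 a h).elim
      · exact fun h => congrArg Fin.succ (h1 h)
      · simp
      · exact fun h => (hz.2 b h.symm).elim
      · exact fun h => (hz.2 a h).elim
      · exact fun h => congrArg Fin.succ (h2 h)
    · rintro ⟨f, v⟩ - ⟨f', v'⟩ - h
      obtain ⟨rfl, rfl⟩ := Fin.cons_injective2 h
      rfl
  refine le_trans ?_ (Nat.cast_le.2 hle)
  rw [Finset.card_sigma, Nat.cast_sum, ← nsmul_eq_mul]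
  exact Finset.card_nsmul_le_sum _ _ _ hK

/-- Greedy extension: if all triples of equally large subsets of relative size at least `η` span
many triangles, then `t` disjoint triangles can be picked one after the other in many ways. -/
lemma le_ncard_triangleEmbeddings {P : Fin 3 → Finset V}
    (hP : ∀ i j, i ≠ j → Disjoint (P i) (P j)) {G : SimpleGraph V} {n : ℕ}
    (hcard : ∀ i, (P i).card = n) {η κ : ℝ} (hκ : 0 ≤ κ)
    (hG : ∀ X ⊆ P 0, ∀ Y ⊆ P 1, ∀ Z ⊆ P 2, ∀ m : ℕ, X.card = m → Y.card = m → Z.card = m →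
      η * n ≤ m → κ * (m : ℝ) ^ 3 ≤ ((crossTriangles G X Y Z).card : ℝ))
    {t : ℕ} (ht : (t : ℝ) ≤ (1 - η) * n) :
    κ ^ t * (n.descFactorial t : ℝ) ^ 3 ≤ ((triangleEmbeddings P t G).ncard : ℝ) := by
  classical
  refine le_trans ?_ (Nat.cast_le.2 (card_disjointTriangleSeqs_le_ncard hP G t))
  induction t with
  | zero => simp [disjointTriangleSeqs, Function.Injective]
  | succ t ih =>
    push_cast at ht
    have ih := ih (by linarith)
    refine le_trans ?_ (mul_card_disjointTriangleSeqs_le (K := κ * ((n - t : ℕ) : ℝ) ^ 3) ?_)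
    · rw [Nat.descFactorial_succ]
      push_cast
      calc κ ^ (t + 1) * (((n - t : ℕ) : ℝ) * (n.descFactorial t : ℝ)) ^ 3
          = κ ^ t * (n.descFactorial t : ℝ) ^ 3 * (κ * ((n - t : ℕ) : ℝ) ^ 3) := by ring
        _ ≤ _ := mul_le_mul_of_nonneg_right ih (by positivity)
    · intro f hf
      obtain ⟨-, hT, h0, h1, h2⟩ := Finset.mem_filter.1 hf
      have hsz : ∀ (i : Fin 3) (u : Fin t → V), Function.Injective u → (∀ s, u s ∈ P i) →
          (P i \ Finset.univ.image u).card = n - t := by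
        intro i u hu hmem
        rw [Finset.card_sdiff_of_subset (by
          intro v hv
          obtain ⟨s, -, rfl⟩ := Finset.mem_image.1 hv
          exact hmem s), Finset.card_image_of_injective _ hu, hcard, Finset.card_fin]
      have hmem := fun s => (mem_crossTriangles.1 (hT s)).1
      refine hG _ Finset.sdiff_subset _ Finset.sdiff_subset _ Finset.sdiff_subset _
        (hsz 0 _ h0 fun s => (hmem s).1) (hsz 1 _ h1 fun s => (hmem s).2.1)
        (hsz 2 _ h2 fun s => (hmem s).2.2) ?_
      have : (n : ℝ) ≤ ((n - t : ℕ) : ℝ) + t := by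
        exact_mod_cast Nat.sub_le_iff_le_add.1 le_rfl
      linarith

end Embeddings

/-! ### Union bound over triples of large sets -/

/-- Above the threshold `(log n)^{1/3} n^{-2/3}` the expected number of triangles `n³p³` dominates
both `n` and `n · n p²`. -/
lemma eventually_mul_le_cube (L : ℝ) :
    ∀ᶠ n : ℕ in atTop, ∀ p : ℝ,
      1 * (Real.log n) ^ (1 / 3 : ℝ) * (n : ℝ) ^ (-(2 / 3) : ℝ) ≤ p →
        L * n * (1 + 3 * n * p ^ 2) ≤ (n * p) ^ 3 := by
  have hlog : Tendsto (fun n : ℕ => Real.log n) atTop atTop :=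
    Real.tendsto_log_atTop.comp tendsto_natCast_atTop_atTop
  filter_upwards [hlog.eventually_ge_atTop (max 1 (2 * L)),
    tendsto_natCast_atTop_atTop.eventually_ge_atTop ((6 * L) ^ 3 : ℝ),
    eventually_ge_atTop 1] with n h1 h2 h3 p hp
  have hn : (0 : ℝ) < n := by exact_mod_cast h3
  have hl1 : 1 ≤ Real.log n := (le_max_left _ _).trans h1
  have hl2 : 2 * L ≤ Real.log n := (le_max_right _ _).trans h1
  have hl0 : 0 ≤ Real.log n := zero_le_one.trans hl1
  rw [one_mul] at hp
  set a := (Real.log n) ^ (1 / 3 : ℝ) with ha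
  set b := (n : ℝ) ^ (-(2 / 3) : ℝ) with hb
  have ha3 : a ^ 3 = Real.log n := by
    rw [ha, ← Real.rpow_natCast, ← Real.rpow_mul hl0]
    norm_num
  have hb3 : b ^ 3 * n ^ 2 = 1 := by
    rw [hb, ← Real.rpow_natCast, ← Real.rpow_mul hn.le, ← Real.rpow_natCast (n : ℝ) 2,
      ← Real.rpow_add hn]
    norm_num
  have ha0 : 0 ≤ a := Real.rpow_nonneg hl0 _
  have hb0 : 0 ≤ b := Real.rpow_nonneg hn.le _
  have hp0 : 0 ≤ p := (mul_nonneg ha0 hb0).trans hp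
  have hx3 : n * Real.log n ≤ (n * p) ^ 3 := by
    calc n * Real.log n = n * a ^ 3 * (b ^ 3 * n ^ 2) := by rw [ha3, hb3, mul_one]
      _ = n ^ 3 * (a * b) ^ 3 := by ring
      _ ≤ n ^ 3 * p ^ 3 := by gcongr
      _ = (n * p) ^ 3 := by ring
  have hx6 : 6 * L ≤ n * p := by
    refine le_of_pow_le_pow_left₀ (n := 3) (by norm_num) (by positivity) ?_
    refine h2.trans (le_trans ?_ hx3)
    exact le_mul_of_one_le_right hn.le hl1
  have h4 : L * n ≤ (n * p) ^ 3 / 2 := by nlinarith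
  have h5 : L * n * (3 * n * p ^ 2) ≤ (n * p) ^ 3 / 2 := by
    calc L * n * (3 * n * p ^ 2) = 6 * L * (n * p) ^ 2 / 2 := by ring
      _ ≤ (n * p) * (n * p) ^ 2 / 2 := by gcongr
      _ = (n * p) ^ 3 / 2 := by ring
  linarith

open Classical in
/-- Janson's inequality and the counting lemma for a fixed triple of large sets, with the exponent
`4 n` needed for a union bound over all `8 ^ n` triples. -/
lemma sum_few_triangles_le {V : Type*} [Fintype V] {Γ : SimpleGraph V} {P : Fin 3 → Finset V}
    {η d p : ℝ} {n m : ℕ} (hη : 0 < η) (hη' : η ≤ 1) (hd : 0 < d) (hd' : d ≤ 1) (hn : 0 < n)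
    (h0 : 0 < p) (h1 : p ≤ 1) (hΓ : IsRegularTripartite Γ P (η ^ 2 * d / 10) d)
    (hP : ∀ i, (P i).card = n)
    (hnp : 64 / (η ^ 5 * d ^ 3) * n * (1 + 3 * n * p ^ 2) ≤ (n * p) ^ 3)
    {X Y Z : Finset V} (hXA : X ⊆ P 0) (hYB : Y ⊆ P 1) (hZC : Z ⊆ P 2) (hX : X.card = m)
    (hY : Y.card = m) (hZ : Z.card = m) (hm : η * n ≤ m) :
    ∑ S ∈ Finset.univ.filter (fun S : Finset (Sym2 V) =>
        ((crossTriangles (SimpleGraph.fromEdgeSet (S : Set (Sym2 V))) X Y Z).card : ℝ) <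
          (1 - η) * (p * d) ^ 3 * (m : ℝ) ^ 3), subsetWeight (edgeProb Γ p) S ≤
      Real.exp (-(4 * n)) := by
  have hn' : (0 : ℝ) < n := Nat.cast_pos.2 hn
  have hm' : (0 : ℝ) < m := (mul_pos hη hn').trans_le hm
  set T : ℝ := ((crossTriangles Γ X Y Z).card : ℝ) with hT
  have hTge : (1 - η / 2) * (d ^ 3 * (m : ℝ) ^ 3) ≤ T :=
    le_card_crossTriangles hη hη' hd hd' hΓ (n := n) (fun i => by rw [hP i]) hXA hYB hZC
      (by rw [hX]) (by rw [hY]) (by rw [hZ]) hm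
  have hsize : ∀ {W : Finset V} {i : Fin 3}, W ⊆ P i → (W.card : ℝ) ≤ n := fun {W i} h => by
    rw [← hP i]
    exact_mod_cast Finset.card_le_card h
  have hdisj : ∀ {W W' : Finset V} {i j : Fin 3}, i ≠ j → W ⊆ P i → W' ⊆ P j → Disjoint W W' :=
    fun hij h h' => Finset.disjoint_of_subset_left h (Finset.disjoint_of_subset_right h'
      (hΓ.1.disjoint _ _ hij))
  have hJ := crossTriangles_lower_tail Γ h0.le h1 (hdisj (by decide) hXA hYB)
    (hdisj (by decide) hXA hZC) (hdisj (by decide) hYB hZC) (hsize hXA) (hsize hYB) (hsize hZC)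
    (c := η / 2) (by positivity)
  refine (Finset.sum_le_sum_of_subset_of_nonneg (fun S hS => ?_) fun S _ _ =>
    subsetWeight_nonneg (edgeProb_nonneg Γ h0.le) (fun e => (edgeProb_le Γ h0.le e).trans h1)
      S).trans (hJ.trans (Real.exp_le_exp.2 (neg_le_neg ?_)))
  · rw [Finset.mem_filter] at hS ⊢
    refine ⟨hS.1, hS.2.le.trans ?_⟩
    -- `1 - η ≤ (1 - η / 2) ^ 2`, one factor for the counting lemma and one for the deviation.
    calc (1 - η) * (p * d) ^ 3 * (m : ℝ) ^ 3
        ≤ (1 - η / 2) ^ 2 * ((p * d) ^ 3 * (m : ℝ) ^ 3) := by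
          rw [mul_assoc]
          exact mul_le_mul_of_nonneg_right (by nlinarith [sq_nonneg η]) (by positivity)
      _ = (1 - η / 2) * (p ^ 3 * ((1 - η / 2) * (d ^ 3 * (m : ℝ) ^ 3))) := by ring
      _ ≤ (1 - η / 2) * (p ^ 3 * T) :=
          mul_le_mul_of_nonneg_left (mul_le_mul_of_nonneg_left hTge (by positivity)) (by linarith)
  · have hT2 : η ^ 3 * d ^ 3 * n ^ 3 / 2 ≤ T := by
      refine le_trans ?_ hTge
      calc η ^ 3 * d ^ 3 * n ^ 3 / 2 = 1 / 2 * (d ^ 3 * (η * n) ^ 3) := by ring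
        _ ≤ (1 - η / 2) * (d ^ 3 * (m : ℝ) ^ 3) :=
          mul_le_mul (by linarith) (by gcongr) (by positivity) (by linarith)
    have hpos : (0 : ℝ) < 1 + 3 * n * p ^ 2 := by positivity
    rw [le_div_iff₀ (by positivity)]
    calc 4 * (n : ℝ) * (2 * (1 + 3 * n * p ^ 2))
        = η ^ 5 * d ^ 3 / 8 * (64 / (η ^ 5 * d ^ 3) * n * (1 + 3 * n * p ^ 2)) := by
          field_simp
          ring
      _ ≤ η ^ 5 * d ^ 3 / 8 * (n * p) ^ 3 := by gcongr
      _ = (η / 2) ^ 2 * (p ^ 3 * (η ^ 3 * d ^ 3 * n ^ 3 / 2)) := by ring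
      _ ≤ (η / 2) ^ 2 * (p ^ 3 * T) := by gcongr

lemma sum_biUnion_le {ι β : Type*} [DecidableEq β] {f : β → ℝ} (hf : ∀ b, 0 ≤ f b) (J : Finset ι)
    (B : ι → Finset β) : ∑ b ∈ J.biUnion B, f b ≤ ∑ x ∈ J, ∑ b ∈ B x, f b := by
  classical
  induction J using Finset.induction_on with
  | empty => simp
  | insert x J hx ih =>
    rw [Finset.biUnion_insert, Finset.sum_insert hx]
    have h := Finset.sum_union_inter (s₁ := B x) (s₂ := J.biUnion B) (f := f)
    linarith [Finset.sum_nonneg fun b (_ : b ∈ B x ∩ J.biUnion B) => hf b]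

open Classical in
/-- The union bound over all triples of large sets. -/
lemma sum_exists_few_triangles_le {V : Type*} [Fintype V] {Γ : SimpleGraph V}
    {P : Fin 3 → Finset V} {η d p : ℝ} {n : ℕ} (hη : 0 < η) (hη' : η ≤ 1) (hd : 0 < d)
    (hd' : d ≤ 1) (hn : 0 < n)
    (h0 : 0 < p) (h1 : p ≤ 1) (hΓ : IsRegularTripartite Γ P (η ^ 2 * d / 10) d)
    (hP : ∀ i, (P i).card = n)
    (hnp : 64 / (η ^ 5 * d ^ 3) * n * (1 + 3 * n * p ^ 2) ≤ (n * p) ^ 3) :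
    ∑ S ∈ Finset.univ.filter (fun S : Finset (Sym2 V) => ¬ ∀ X ⊆ P 0, ∀ Y ⊆ P 1, ∀ Z ⊆ P 2,
        ∀ m : ℕ, X.card = m → Y.card = m → Z.card = m → η * n ≤ m →
          (1 - η) * (p * d) ^ 3 * (m : ℝ) ^ 3 ≤
            ((crossTriangles (SimpleGraph.fromEdgeSet (S : Set (Sym2 V))) X Y Z).card : ℝ)),
      subsetWeight (edgeProb Γ p) S ≤ Real.exp (-n) := by
  set J : Finset (Finset V × Finset V × Finset V) :=
    ((P 0).powerset ×ˢ (P 1).powerset ×ˢ (P 2).powerset).filter fun x =>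
      x.2.1.card = x.1.card ∧ x.2.2.card = x.1.card ∧ η * n ≤ x.1.card with hJ
  have hw : ∀ S, 0 ≤ subsetWeight (edgeProb Γ p) S :=
    subsetWeight_nonneg (edgeProb_nonneg Γ h0.le) fun e => (edgeProb_le Γ h0.le e).trans h1
  set B : Finset V × Finset V × Finset V → Finset (Finset (Sym2 V)) := fun x =>
    Finset.univ.filter (fun S : Finset (Sym2 V) =>
        ((crossTriangles (SimpleGraph.fromEdgeSet (S : Set (Sym2 V))) x.1 x.2.1 x.2.2).card : ℝ) <
          (1 - η) * (p * d) ^ 3 * (x.1.card : ℝ) ^ 3) with hB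
  have hJcard : (J.card : ℝ) ≤ Real.exp (3 * n) := by
    have h2 : (2 : ℝ) ≤ Real.exp 1 := by linarith [Real.add_one_le_exp (1 : ℝ)]
    calc (J.card : ℝ)
        ≤ (((P 0).powerset ×ˢ (P 1).powerset ×ˢ (P 2).powerset).card : ℝ) := by
          exact_mod_cast Finset.card_filter_le _ _
      _ = 2 ^ (3 * n) := by
          simp only [Finset.card_product, Finset.card_powerset, hP]
          push_cast
          ring
      _ ≤ Real.exp 1 ^ (3 * n) := by gcongr
      _ = Real.exp (3 * n) := by
          rw [← Real.exp_nat_mul]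
          push_cast
          ring_nf
  calc _ ≤ ∑ S ∈ J.biUnion B, subsetWeight (edgeProb Γ p) S := by
        refine Finset.sum_le_sum_of_subset_of_nonneg (fun S hS => ?_) fun S _ _ => hw S
        have hS := (Finset.mem_filter.1 hS).2
        push Not at hS
        obtain ⟨X, hX, Y, hY, Z, hZ, m, rfl, hYm, hZm, hm, hlt⟩ := hS
        refine Finset.mem_biUnion.2 ⟨(X, Y, Z), ?_, ?_⟩
        · simp only [hJ, Finset.mem_filter, Finset.mem_product, Finset.mem_powerset]
          exact ⟨⟨hX, hY, hZ⟩, hYm, hZm, hm⟩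
        · exact Finset.mem_filter.2 ⟨Finset.mem_univ _, hlt⟩
    _ ≤ ∑ x ∈ J, ∑ S ∈ B x, subsetWeight (edgeProb Γ p) S := sum_biUnion_le hw J B
    _ ≤ ∑ x ∈ J, Real.exp (-(4 * n)) := by
        refine Finset.sum_le_sum fun x hx => ?_
        simp only [hJ, Finset.mem_filter, Finset.mem_product, Finset.mem_powerset] at hx
        obtain ⟨⟨hX, hY, hZ⟩, hYm, hZm, hm⟩ := hx
        exact sum_few_triangles_le hη hη' hd hd' hn h0 h1 hΓ hP hnp hX hY hZ rfl hYm hZm hm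
    _ ≤ Real.exp (-n) := by
        rw [Finset.sum_const, nsmul_eq_mul]
        refine (mul_le_mul_of_nonneg_right hJcard (Real.exp_nonneg _)).trans (le_of_eq ?_)
        rw [← Real.exp_add]
        ring_nf

end TriangleFactor

theorem proposition3p2 (η d : ℝ) (hη : 0 < η) (hη' : η ≤ 1) (hd : 0 < d) (hd' : d ≤ 1) :
    ∃ ε : ℝ, 0 < ε ∧ ∃ C : ℝ, 0 < C ∧
      ∀ δ : ℝ, 0 < δ → ∀ᶠ n : ℕ in atTop,
        ∀ p : unitInterval,
          C * (Real.log n) ^ (1 / 3 : ℝ) * (n : ℝ) ^ (-(2 / 3) : ℝ) ≤ (p : ℝ) →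
        ∀ (V : Type*) [Fintype V] (Γ : SimpleGraph V) (P : Fin 3 → Finset V),
          (∀ i, (P i).card = n) →
          TriangleFactor.IsRegularTripartite Γ P ε d →
          1 - δ ≤ (TriangleFactor.sparsification Γ p).real
            {G | ∀ t : ℕ, (t : ℝ) ≤ (1 - η) * n →
              (1 - η) ^ t * ((p : ℝ) * d) ^ (3 * t) * ((n.descFactorial t : ℕ) : ℝ) ^ 3 ≤
                ((TriangleFactor.triangleEmbeddings P t G).ncard : ℝ)} := by
  classical
  refine ⟨η ^ 2 * d / 10, by positivity, 1, one_pos, fun δ hδ => ?_⟩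
  have hexp : Tendsto (fun n : ℕ => Real.exp (-(n : ℝ))) atTop (nhds 0) :=
    Real.tendsto_exp_neg_atTop_nhds_zero.comp tendsto_natCast_atTop_atTop
  filter_upwards [TriangleFactor.eventually_mul_le_cube (64 / (η ^ 5 * d ^ 3)),
    hexp.eventually_le_const hδ, eventually_gt_atTop 0] with n hcube hnδ hn p hp V _ Γ P hP hΓ
  have hn' : (0 : ℝ) < n := Nat.cast_pos.2 hn
  have hnp := hcube p hp
  have hp0 : (0 : ℝ) < p := by
    refine lt_of_le_of_ne p.2.1 fun h => ?_
    rw [← h] at hnp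
    have : (0 : ℝ) < 64 / (η ^ 5 * d ^ 3) * n * (1 + 3 * n * 0 ^ 2) := by positivity
    norm_num at hnp this
    linarith
  have hsum := TriangleFactor.sum_exists_few_triangles_le hη hη' hd hd' hn hp0 p.2.2 hΓ hP hnp
  refine le_trans ?_ (TriangleFactor.one_sub_sum_le_sparsification Γ p _)
  refine sub_le_sub_left (le_trans (Finset.sum_le_sum_of_subset_of_nonneg ?_ fun S _ _ =>
    TriangleFactor.subsetWeight_nonneg (TriangleFactor.edgeProb_nonneg Γ hp0.le)
      (fun e => (TriangleFactor.edgeProb_le Γ hp0.le e).trans p.2.2) S) (hsum.trans hnδ)) 1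
  refine Finset.monotone_filter_right _ fun S _ hS hG => hS fun t ht => ?_
  have h := TriangleFactor.le_ncard_triangleEmbeddings hΓ.1.disjoint hP
    (κ := (1 - η) * (p * d) ^ 3)
    (mul_nonneg (sub_nonneg.2 hη') (by positivity)) hG ht
  rwa [mul_pow, ← pow_mul] at h
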